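/- Let $\Lambda\subset\mathbb C$ be a period lattice with Weierstrass function $\sigma(z)=z\prod_{0\ne\omega\in\Lambda}(1-z/\omega)\,e^{z/\omega+z^2/(2\omega^2)}$. Let $\alpha,\beta\in\mathbb C$ and let $\xi_i,\widetilde\xi_i,\widehat\xi_i,\widehat{\widetilde\xi}_i\in\mathbb C$ ($i=1,2,3$) be the values of the dependent variables at the four vertices of an elementary quadrilateral. For $i,j\in\{1,2,3\}$ and $l\in\{1,2\}$ put $$A_{ilj}=\frac{\sigma(\widehat{\widetilde\xi}_i-\widehat\xi_l-\widehat\xi_3+\xi_j-\alpha+\beta)\,\sigma(\widehat\xi_l-\widehat\xi_3)}{\sigma(\widehat{\widetilde\xi}_i-\widehat\xi_l-\alpha)\,\sigma(\widehat\xi_l-\xi_j-\beta)\,\sigma(\widehat{\widetilde\xi}_i-\widehat\xi_3-\alpha)\,\sigma(\widehat\xi_3-\xi_j-\beta)},$$ $$B_{ilj}=\frac{\sigma(\widehat{\widetilde\xi}_i-\widetilde\xi_l-\widetilde\xi_3+\xi_j+\alpha-\beta)\,\sigma(\widetilde\xi_l-\widetilde\xi_3)}{\sigma(\widehat{\widetilde\xi}_i-\widetilde\xi_l-\beta)\,\sigma(\widetilde\xi_l-\xi_j-\alpha)\,\sigma(\widehat{\widetilde\xi}_i-\widetilde\xi_3-\beta)\,\sigma(\widetilde\xi_3-\xi_j-\alpha)},$$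 and assume that no denominator vanishes, i.e. that for all $i,m,j\in\{1,2,3\}$ none of $\widehat{\widetilde\xi}_i-\widehat\xi_m-\alpha$, $\widehat\xi_m-\xi_j-\beta$, $\widehat{\widetilde\xi}_i-\widetilde\xi_m-\beta$, $\widetilde\xi_m-\xi_j-\alpha$ lies in $\Lambda$. These are the coefficients of the bilinear system that arises from the compatibility of the rank-3 elliptic Lax pair, in the unknowns $\widehat h_1,\widehat h_2,\widetilde k_1,\widetilde k_2$: $$E^{(j)}_{i,i''}:\quad \sum_{p,q=1}^{2}\bigl(A_{ipj}B_{i''qj}-A_{i''pj}B_{iqj}\bigr)\,\widehat h_p\,\widetilde k_q=0 .$$ For a $2\times2\times2$ hypermatrix $a=(a_{pqr})_{p,q,r\in\{0,1\}}$ let $$\operatorname{Det}(a)=\left(\begin{vmatrix}a_{000}&a_{001}\\a_{110}&a_{111}\end{vmatrix}+\begin{vmatrix}a_{100}&a_{010}\\a_{101}&a_{011}\end{vmatrix}\right)^2-4\begin{vmatrix}a_{000}&a_{001}\\a_{010}&a_{011}\end{vmatrix}\begin{vmatrix}a_{100}&a_{101}\\a_{110}&a_{111}\end{vmatrix}.$$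 (1) Let $j,i,i',i''\in\{1,2,3\}$ (for instance $i=1$, $i'=2$, $i''=3$) and $\{l,l'\}=\{1,2\}$. There is exactly one hypermatrix $T$ such that, with $(x_0,x_1)=(\widehat h_l,\widehat h_{l'})$ and $(y_0,y_1)=(\widetilde k_l,\widetilde k_{l'})$, the form $\sum_{p,q}T_{pqr}x_py_q$ is identically (in $\widehat h,\widetilde k$) the left-hand side of $E^{(j)}_{i,i''}$ for $r=0$ and of $E^{(j)}_{i',i''}$ for $r=1$. It is given by $T_{pqr}=A_{i_rl_pj}B_{i''l_qj}-A_{i''l_pj}B_{i_rl_qj}$, where $(i_0,i_1)=(i,i')$ and $(l_0,l_1)=(l,l')$. It has the compound form: with $$(a,a',a'')=(A_{ilj},A_{i'lj},A_{i''lj}),\quad (b,b',b'')=(B_{ilj},B_{i'lj},B_{i''lj}),$$ $$(c,c',c'')=(A_{il'j},A_{i'l'j},A_{i''l'j}),\quad (d,d',d'')=(B_{il'j},B_{i'l'j},B_{i''l'j}),$$ and $[uv]=uv''-u''v$, $[u'v']=u'v''-u''v'$ for $u,v\in\{a,b,c,d\}$, the entry $T_{pq0}$ is $[uv]$ and the entry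 $T_{pq1}$ is $[u'v']$, where $u=a,c$ for $p=0,1$ and $v=b,d$ for $q=0,1$. Its hyperdeterminant is $$\operatorname{Det}(T)=\left(\begin{vmatrix}[ab]&[a'd']\\ [cb]&[c'd']\end{vmatrix}+\begin{vmatrix}[a'b']&[ad]\\ [c'b']&[cd]\end{vmatrix}\right)^2-4\begin{vmatrix}[ab]&[ad]\\ [cb]&[cd]\end{vmatrix}\begin{vmatrix}[a'b']&[a'd']\\ [c'b']&[c'd']\end{vmatrix},$$ and it is the perfect square $$\operatorname{Det}(T)=\begin{vmatrix}\begin{vmatrix}A_{ilj}&A_{il'j}\\A_{i''lj}&A_{i''l'j}\end{vmatrix}&\begin{vmatrix}A_{i'lj}&A_{i'l'j}\\A_{i''lj}&A_{i''l'j}\end{vmatrix}\\[3ex]\begin{vmatrix}B_{ilj}&B_{il'j}\\B_{i''lj}&B_{i''l'j}\end{vmatrix}&\begin{vmatrix}B_{i'lj}&B_{i'l'j}\\B_{i''lj}&B_{i''l'j}\end{vmatrix}\end{vmatrix}^{\,2}.$$ (2) For all $i,i'',j\in\{1,2,3\}$ and $l,l'\in\{1,2\}$, $$\begin{vmatrix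}A_{ilj}&A_{il'j}\\A_{i''lj}&A_{i''l'j}\end{vmatrix}=\frac{\sigma(\widehat\xi_l-\widehat\xi_3)\,\sigma(\widehat\xi_{l'}-\widehat\xi_3)\,\sigma(\widehat\xi_l-\widehat\xi_{l'})}{\sigma(\widehat{\widetilde\xi}_i-\widehat\xi_l-\alpha)\,\sigma(\widehat{\widetilde\xi}_i-\widehat\xi_{l'}-\alpha)\,\sigma(\widehat{\widetilde\xi}_{i''}-\widehat\xi_l-\alpha)\,\sigma(\widehat{\widetilde\xi}_{i''}-\widehat\xi_{l'}-\alpha)}$$ $$\times\frac{\sigma(\widehat{\widetilde\xi}_i-\widehat{\widetilde\xi}_{i''})\,\sigma(\widehat{\widetilde\xi}_i+\widehat{\widetilde\xi}_{i''}-\widehat\xi_l-\widehat\xi_{l'}-\widehat\xi_3+\xi_j-2\alpha+\beta)}{\sigma(\widehat{\widetilde\xi}_i-\widehat\xi_3-\alpha)\,\sigma(\widehat{\widetilde\xi}_{i''}-\widehat\xi_3-\alpha)\,\sigma(\widehat\xi_l-\xi_j-\beta)\,\sigma(\widehat\xi_{l'}-\xi_j-\beta)\,\sigma(\widehat\xi_3-\xi_j-\beta)},$$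 and the determinant with $B$ in place of $A$ is given by the same formula with $\alpha$ and $\beta$ interchanged and $\widehat\xi$ replaced by $\widetilde\xi$ throughout (the doubly shifted $\widehat{\widetilde\xi}$ is unchanged). -/

import Mathlib

noncomputable section

namespace EllipticLax

/-- The Weierstrass `σ`-function of the period lattice `Λ` of `L`:
`σ(z) = z ∏_{ω ∈ Λ, ω ≠ 0} (1 - z/ω) exp(z/ω + (z/ω)²/2)`. -/
def sigma (L : PeriodPair) (z : ℂ) : ℂ :=
  z * ∏' ω : {ω : L.lattice // ω ≠ 0},
    (1 - z / (ω : ℂ)) * Complex.exp (z / (ω : ℂ) + (z / (ω : ℂ)) ^ 2 / 2)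

/-- The coefficients `A_{ilj}`, as a function of the values `η` of the variables at the
doubly shifted vertex, `ξh` at the hat-shifted vertex, and `ξ` at the base vertex.
Indices `1, 2, 3` of the text are `0, 1, 2` here; the index `l` only takes the values `1, 2`
since the third coefficients have been eliminated. -/
def coeffA (L : PeriodPair) (α β : ℂ) (η ξh ξ : Fin 3 → ℂ) (i : Fin 3) (l : Fin 2)
    (j : Fin 3) : ℂ :=
  (sigma L (η i - ξh l.castSucc - ξh 2 + ξ j - α + β) * sigma L (ξh l.castSucc - ξh 2)) /
    (sigma L (η i - ξh l.castSucc - α) * sigma L (ξh l.castSucc - ξ j - β) *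
      sigma L (η i - ξh 2 - α) * sigma L (ξh 2 - ξ j - β))

/-- The coefficients `B_{ilj}`, as a function of the values `η` of the variables at the
doubly shifted vertex, `ξt` at the tilde-shifted vertex, and `ξ` at the base vertex. -/
def coeffB (L : PeriodPair) (α β : ℂ) (η ξt ξ : Fin 3 → ℂ) (i : Fin 3) (l : Fin 2)
    (j : Fin 3) : ℂ :=
  (sigma L (η i - ξt l.castSucc - ξt 2 + ξ j + α - β) * sigma L (ξt l.castSucc - ξt 2)) /
    (sigma L (η i - ξt l.castSucc - β) * sigma L (ξt l.castSucc - ξ j - α) *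
      sigma L (η i - ξt 2 - β) * sigma L (ξt 2 - ξ j - α))

/-- The left-hand side of the bilinear equation (at fixed `j`) that comes from equating the rows
`i` and `i₂`, in the unknowns `h = (ĥ₁, ĥ₂)` and `k = (k̃₁, k̃₂)`; here `A i l` and `B i l`
stand for `A_{ilj}` and `B_{ilj}`. The bilinear system consists of the equations for
`(i, i₂) = (1, 2), (1, 3), (2, 3)`. -/
def bilinearForm (A B : Fin 3 → Fin 2 → ℂ) (i i₂ : Fin 3) (h k : Fin 2 → ℂ) : ℂ :=
  (A i 0 * B i₂ 0 - A i₂ 0 * B i 0) * h 0 * k 0 + (A i 0 * B i₂ 1 - A i₂ 0 * B i 1) * h 0 * k 1 +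
    (A i 1 * B i₂ 0 - A i₂ 1 * B i 0) * h 1 * k 0 + (A i 1 * B i₂ 1 - A i₂ 1 * B i 1) * h 1 * k 1

/-- A `2 × 2 × 2` hypermatrix `(a_{pqr})`, `p, q, r = 0, 1`. -/
abbrev Hypermatrix : Type := Fin 2 → Fin 2 → Fin 2 → ℂ

/-- Cayley's hyperdeterminant of a `2 × 2 × 2` hypermatrix. -/
def hyperdet (a : Hypermatrix) : ℂ :=
  (!![a 0 0 0, a 0 0 1; a 1 1 0, a 1 1 1].det + !![a 1 0 0, a 0 1 0; a 1 0 1, a 0 1 1].det) ^ 2 -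
    4 * !![a 0 0 0, a 0 0 1; a 0 1 0, a 0 1 1].det * !![a 1 0 0, a 1 0 1; a 1 1 0, a 1 1 1].det

/-- The form `a_{00r} x₀ y₀ + a_{01r} x₀ y₁ + a_{10r} x₁ y₀ + a_{11r} x₁ y₁`; its vanishing for
`r = 1` and for `r = 0` are the two `x`-`y` equations of Cayley's system of six bilinear
equations in `x`, `y`, `z` attached to the hypermatrix `a`. -/
def cayleyForm (a : Hypermatrix) (r : Fin 2) (x y : Fin 2 → ℂ) : ℂ :=
  a 0 0 r * x 0 * y 0 + a 0 1 r * x 0 * y 1 + a 1 0 r * x 1 * y 0 + a 1 1 r * x 1 * y 1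

/-- The two `x`-`y` equations of Cayley's system for the hypermatrix `a`, with
`x = (ĥ_l, ĥ_{l₁})` and `y = (k̃_l, k̃_{l₁})`, are coefficient by coefficient the bilinear
equations for the rows `(i, i₂)` and `(i₁, i₂)`. -/
def IsIdentified (A B : Fin 3 → Fin 2 → ℂ) (i i₁ i₂ : Fin 3) (l l₁ : Fin 2)
    (a : Hypermatrix) : Prop :=
  ∀ h k : Fin 2 → ℂ,
    cayleyForm a 0 ![h l, h l₁] ![k l, k l₁] = bilinearForm A B i i₂ h k ∧
    cayleyForm a 1 ![h l, h l₁] ![k l, k l₁] = bilinearForm A B i₁ i₂ h k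

/-- The hypermatrix of the bilinear equations for the rows `(i, i₂)` and `(i₁, i₂)`. -/
def systemHypermatrix (A B : Fin 3 → Fin 2 → ℂ) (i i₁ i₂ : Fin 3) (l l₁ : Fin 2) :
    Hypermatrix :=
  fun p q r => A (![i, i₁] r) (![l, l₁] p) * B i₂ (![l, l₁] q) -
    A i₂ (![l, l₁] p) * B (![i, i₁] r) (![l, l₁] q)

/-- The compound hypermatrix of `a = (a, a', a'')`, `b = (b, b', b'')`, `c = (c, c', c'')`,
`d = (d, d', d'')`: its entry at `(r, q, p)` is the determinant `|u u''; v v''|` if `r = 0` and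
`|u' u''; v' v''|` if `r = 1`, where `u` is `a` or `c` (for `p = 0, 1`) and `v` is `b` or `d`
(for `q = 0, 1`). -/
def compoundHypermatrix (a b c d : Fin 3 → ℂ) : Hypermatrix :=
  fun r q p => !![(![a, c] p) r.castSucc, (![a, c] p) 2;
    (![b, d] q) r.castSucc, (![b, d] q) 2].det

/-- The compound form of the hyperdeterminant, written out in terms of the determinants
`m u v r = |u u''; v v''|` (`r = 0`) or `|u' u''; v' v''|` (`r = 1`). -/
def compoundHyperdet (a b c d : Fin 3 → ℂ) : ℂ :=
  let m : (Fin 3 → ℂ) → (Fin 3 → ℂ) → Fin 2 → ℂ := fun u v r =>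
    !![u r.castSucc, u 2; v r.castSucc, v 2].det
  (!![m a b 0, m a d 1; m c b 0, m c d 1].det + !![m a b 1, m a d 0; m c b 1, m c d 0].det) ^ 2 -
    4 * !![m a b 0, m a d 0; m c b 0, m c d 0].det * !![m a b 1, m a d 1; m c b 1, m c d 1].det

/-- The `2 × 2` determinant of the entries `X_{il}, X_{il₁}; X_{i₂l}, X_{i₂l₁}`. -/
def minor (X : Fin 3 → Fin 2 → ℂ) (i i₂ : Fin 3) (l l₁ : Fin 2) : ℂ :=
  !![X i l, X i l₁; X i₂ l, X i₂ l₁].det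

/-- The explicit product of `σ`-functions for the `2 × 2` determinants of the `A_{ilj}`. -/
def sigmaProduct (L : PeriodPair) (α β : ℂ) (η ξh ξ : Fin 3 → ℂ) (i i₂ : Fin 3) (l l₁ : Fin 2)
    (j : Fin 3) : ℂ :=
  (sigma L (ξh l.castSucc - ξh 2) * sigma L (ξh l₁.castSucc - ξh 2) *
      sigma L (ξh l.castSucc - ξh l₁.castSucc)) /
    (sigma L (η i - ξh l.castSucc - α) * sigma L (η i - ξh l₁.castSucc - α) *
      sigma L (η i₂ - ξh l.castSucc - α) * sigma L (η i₂ - ξh l₁.castSucc - α)) *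
  ((sigma L (η i - η i₂) *
      sigma L (η i + η i₂ - ξh l.castSucc - ξh l₁.castSucc - ξh 2 + ξ j - 2 * α + β)) /
    (sigma L (η i - ξh 2 - α) * sigma L (η i₂ - ξh 2 - α) * sigma L (ξh l.castSucc - ξ j - β) *
      sigma L (ξh l₁.castSucc - ξ j - β) * sigma L (ξh 2 - ξ j - β)))

end EllipticLax

end

/-!
The statements about the hypermatrix hold for arbitrary coefficients `A`, `B`: its entries are the
coefficients of the bilinear forms, and the formulas for the hyperdeterminant are polynomial
identities in the entries of `A` and `B`.

The factorisation of the minors of `A` is, after clearing denominators, the three-term relation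
`sigma_three_term` of the Weierstrass `σ`-function; for `B` one exchanges `α` and `β`.

The three-term relation is proved by comparing theta functions. Both sides, as functions of `u`,
are combinations of products `σ(u - p) σ(u - q)` with the same `p + q`, so they have the same
multipliers along the lattice. For generic `v` the product `σ(u - v) σ(u + v - a - b - t)` on the
right has simple zeros, at the translates of two points at which the left-hand side vanishes too;
the quotient of the left-hand side by this product is then entire and
elliptic, hence constant (`exists_eq_const_mul_of_same_multiplier`), and the constant is read off at
one value of `u`. The exceptional values of `v` form a countable set and are reached by continuity.

What is needed of `σ` is that it is entire, odd, with simple zeros exactly on the lattice, and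
quasi-periodic. The product converges locally uniformly because the factor of `ω` is
`1 + O(|ω|⁻³)`. Quasi-periodicity (`exists_sigma_add_eq`) follows from `(log σ)'' = -℘`
and the periodicity of `℘`: the logarithmic derivatives of `σ(z + ω)` and `σ(z)` differ by a
constant on the connected complement of the lattice.
-/

namespace EllipticLax

open Complex Filter Topology

/-! ### The canonical factors -/

/-- The factor of the product defining `σ` that belongs to `ω`. The conventions on division by
zero make it identically `1` for `ω = 0`. -/
noncomputable def sigmaFactor (ω z : ℂ) : ℂ :=
  (1 - z / ω) * exp (z / ω + (z / ω) ^ 2 / 2)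

lemma norm_one_sub_mul_exp_sub_one_le {w : ℂ} (hw : ‖w‖ ≤ 1 / 2) :
    ‖(1 - w) * exp (w + w ^ 2 / 2) - 1‖ ≤ 2 * ‖w‖ ^ 3 := by
  have hw1 : ‖-w‖ < 1 := by rw [norm_neg]; linarith
  have hne : 1 - w ≠ 0 := by
    intro h
    rw [← sub_eq_zero.mp h, norm_one] at hw
    norm_num at hw
  have hlog := norm_log_sub_logTaylor_le 2 hw1
  rw [norm_neg, ← sub_eq_add_neg] at hlog
  have htaylor : logTaylor (2 + 1) (-w) = -(w + w ^ 2 / 2) := by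
    simp [logTaylor, Finset.sum_range_succ]
    ring
  rw [htaylor, sub_neg_eq_add] at hlog
  have hinv : (1 - ‖w‖)⁻¹ ≤ 2 := by
    rw [inv_le_comm₀ (by linarith) (by norm_num)]
    linarith
  have hle : ‖log (1 - w) + (w + w ^ 2 / 2)‖ ≤ ‖w‖ ^ 3 := by
    refine hlog.trans ?_
    have h3 : 0 ≤ ‖w‖ ^ 3 := by positivity
    norm_num
    nlinarith
  have hexp : (1 - w) * exp (w + w ^ 2 / 2) = exp (log (1 - w) + (w + w ^ 2 / 2)) := by
    rw [exp_add (log (1 - w)), exp_log hne]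
  rw [hexp]
  have h1 : ‖w‖ ^ 3 ≤ 1 := pow_le_one₀ (norm_nonneg _) (by linarith)
  exact (norm_exp_sub_one_le (hle.trans h1)).trans (by linarith)

lemma differentiable_sigmaFactor (ω : ℂ) : Differentiable ℂ (sigmaFactor ω) := by
  unfold sigmaFactor
  fun_prop

@[simp] lemma sigmaFactor_zero_left (z : ℂ) : sigmaFactor 0 z = 1 := by simp [sigmaFactor]

@[simp] lemma sigmaFactor_zero_right (ω : ℂ) : sigmaFactor ω 0 = 1 := by simp [sigmaFactor]

lemma sigmaFactor_neg_neg (ω z : ℂ) : sigmaFactor (-ω) (-z) = sigmaFactor ω z := by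
  simp [sigmaFactor]

lemma sigmaFactor_ne_zero {ω z : ℂ} (h : z ≠ ω) : sigmaFactor ω z ≠ 0 := by
  rcases eq_or_ne ω 0 with rfl | hω
  · simp
  refine mul_ne_zero (fun h0 ↦ h ?_) (exp_ne_zero _)
  field_simp at h0
  linear_combination -h0

lemma logDeriv_sigmaFactor {ω z : ℂ} (h : z ≠ ω) :
    logDeriv (sigmaFactor ω) z = z ^ 2 / (ω ^ 2 * (z - ω)) := by
  rcases eq_or_ne ω 0 with rfl | hω
  · have : sigmaFactor 0 = fun _ ↦ (1 : ℂ) := funext sigmaFactor_zero_left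
    simp [this]
  have h1 : (1 : ℂ) - z / ω ≠ 0 := by
    intro h0
    field_simp at h0
    exact h (by linear_combination -h0)
  have h2 : z - ω ≠ 0 := sub_ne_zero.mpr h
  have hd1 : HasDerivAt (fun z : ℂ ↦ 1 - z / ω) (-(1 / ω)) z :=
    ((hasDerivAt_id z).div_const ω).const_sub 1
  have hd2 : HasDerivAt (fun z : ℂ ↦ exp (z / ω + (z / ω) ^ 2 / 2))
      (exp (z / ω + (z / ω) ^ 2 / 2) * (1 / ω + z / ω ^ 2)) z := by
    have hq : HasDerivAt (fun z : ℂ ↦ z / ω) (1 / ω) z := (hasDerivAt_id z).div_const ω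
    refine ((hq.add ((hq.pow 2).div_const 2)).cexp).congr_deriv ?_
    simp only [Pi.add_apply, Pi.pow_apply]
    push_cast
    ring
  have hd := hd1.mul hd2
  have he := exp_ne_zero (z / ω + (z / ω) ^ 2 / 2)
  rw [logDeriv_apply]
  have : deriv (sigmaFactor ω) z = _ := hd.deriv
  rw [this, sigmaFactor]
  have key : (-(1 / ω) + (1 - z / ω) * (1 / ω + z / ω ^ 2)) / (1 - z / ω) =
      z ^ 2 / (ω ^ 2 * (z - ω)) := by
    rw [div_eq_div_iff h1 (by positivity)]
    field_simp
    ring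
  rw [← key, div_eq_div_iff (mul_ne_zero h1 he) h1]
  ring

/-! ### Convergence of the product -/

variable (L : PeriodPair)

lemma summable_lattice_norm_rpow : Summable fun ω : L.lattice ↦ ‖(ω : ℂ)‖ ^ (-3 : ℝ) :=
  ZLattice.summable_norm_rpow L.lattice _ (by simp; norm_num)

lemma norm_sigmaFactor_sub_one_le {r : ℝ} (hr : 0 < r) {ω z : ℂ} (hz : ‖z‖ ≤ r)
    (hω : 2 * r ≤ ‖ω‖) : ‖sigmaFactor ω z - 1‖ ≤ 2 * r ^ 3 * ‖ω‖ ^ (-3 : ℝ) := by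
  have hω0 : 0 < ‖ω‖ := by linarith
  have hw : ‖z / ω‖ ≤ 1 / 2 := by
    rw [norm_div, div_le_div_iff₀ hω0 (by norm_num)]
    linarith
  refine (norm_one_sub_mul_exp_sub_one_le hw).trans ?_
  have : ‖ω‖ ^ (-3 : ℝ) = (‖ω‖ ^ 3)⁻¹ := by
    rw [Real.rpow_neg hω0.le]
    norm_cast
  rw [this, norm_div, div_pow, mul_assoc, div_eq_mul_inv]
  gcongr

lemma eventually_cofinite_le_norm (R : ℝ) :
    ∀ᶠ ω : L.lattice in cofinite, R ≤ ‖(ω : ℂ)‖ := by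
  refine (isCompact_iff_finite.mp (isCompact_closedBall (0 : L.lattice) R)).subset ?_
  intro ω hω
  simp only [Set.mem_compl_iff, Set.mem_ofPred_eq, not_le] at hω
  simpa using hω.le

lemma eventually_norm_sigmaFactor_sub_one_le {r : ℝ} (hr : 0 < r) :
    ∀ᶠ ω : L.lattice in cofinite, ∀ z ∈ Metric.closedBall (0 : ℂ) r,
      ‖sigmaFactor ω z - 1‖ ≤ 2 * r ^ 3 * ‖(ω : ℂ)‖ ^ (-3 : ℝ) := by
  filter_upwards [eventually_cofinite_le_norm L (2 * r)] with ω hω z hz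
  exact norm_sigmaFactor_sub_one_le hr (by simpa using hz) hω

lemma multipliableLocallyUniformlyOn_sigmaFactor :
    MultipliableLocallyUniformlyOn (fun (ω : L.lattice) z ↦ sigmaFactor ω z) Set.univ := by
  refine ⟨fun z ↦ ∏' ω : L.lattice, sigmaFactor ω z,
    hasProdLocallyUniformlyOn_of_forall_compact isOpen_univ fun K _ hK ↦ ?_⟩
  obtain ⟨r, hr, hKr⟩ := hK.isBounded.exists_pos_norm_le
  have := Summable.hasProdUniformlyOn_one_add hK
    (f := fun (ω : L.lattice) z ↦ sigmaFactor ω z - 1)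
    ((summable_lattice_norm_rpow L).mul_left (2 * r ^ 3))
    (by
      filter_upwards [eventually_norm_sigmaFactor_sub_one_le L hr] with ω hω z hz
      exact hω z (by simpa using hKr z hz))
    (fun ω ↦ ((differentiable_sigmaFactor ω).continuous.sub continuous_const).continuousOn)
  simpa using this

lemma summable_norm_sigmaFactor_sub_one (z : ℂ) :
    Summable fun ω : L.lattice ↦ ‖sigmaFactor ω z - 1‖ := by
  have hr : 0 < ‖z‖ + 1 := by positivity
  refine ((summable_lattice_norm_rpow L).mul_left
    (2 * (‖z‖ + 1) ^ 3)).of_norm_bounded_eventually ?_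
  filter_upwards [eventually_norm_sigmaFactor_sub_one_le L hr] with ω hω
  simpa using hω z (by simp)

/-- The product of all canonical factors, that is `σ(z) / z`. -/
noncomputable def sigmaProd (z : ℂ) : ℂ := ∏' ω : L.lattice, sigmaFactor ω z

lemma sigma_eq_mul_sigmaProd (z : ℂ) : sigma L z = z * sigmaProd L z := by
  have : ∏' ω : {ω : L.lattice // ω ≠ 0}, sigmaFactor (ω : ℂ) z = sigmaProd L z := by
    refine tprod_subtype_eq_of_mulSupport_subset (s := {ω : L.lattice | ω ≠ 0})
      (f := fun ω : L.lattice ↦ sigmaFactor ω z) ?_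
    rintro ω hω rfl
    simp at hω
  rw [← this]
  rfl

lemma differentiable_sigmaProd : Differentiable ℂ (sigmaProd L) := by
  rw [← differentiableOn_univ]
  exact (multipliableLocallyUniformlyOn_sigmaFactor L).hasProdLocallyUniformlyOn.differentiableOn
    (.of_forall fun s ↦ DifferentiableOn.fun_finsetProd fun ω _ ↦
      (differentiable_sigmaFactor ω).differentiableOn) isOpen_univ

lemma sigmaProd_ne_zero {z : ℂ} (hz : z ∉ L.lattice ∨ z = 0) : sigmaProd L z ≠ 0 := by
  have hf : ∀ ω : L.lattice, 1 + (sigmaFactor ω z - 1) ≠ 0 := by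
    intro ω
    rw [add_sub_cancel]
    rcases hz with hz | rfl
    · exact sigmaFactor_ne_zero fun h ↦ hz (h ▸ ω.2)
    · simp
  have := tprod_one_add_ne_zero_of_summable hf (summable_norm_sigmaFactor_sub_one L z)
  simpa [sigmaProd] using this

lemma sigmaProd_neg (z : ℂ) : sigmaProd L (-z) = sigmaProd L z := by
  rw [sigmaProd, ← (Equiv.neg L.lattice).tprod_eq]
  exact tprod_congr fun ω ↦ by simpa using sigmaFactor_neg_neg ω z

/-! ### Elementary properties of `σ` -/

lemma differentiable_sigma : Differentiable ℂ (sigma L) := by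
  rw [funext (sigma_eq_mul_sigmaProd L)]
  exact differentiable_id.mul (differentiable_sigmaProd L)

@[fun_prop] lemma continuous_sigma : Continuous (sigma L) := (differentiable_sigma L).continuous

@[simp] lemma sigma_zero : sigma L 0 = 0 := by simp [sigma]

lemma sigma_neg (z : ℂ) : sigma L (-z) = -sigma L z := by
  simp [sigma_eq_mul_sigmaProd, sigmaProd_neg]

lemma sigma_sub_comm (z w : ℂ) : sigma L (z - w) = -sigma L (w - z) := by
  rw [← sigma_neg, neg_sub]

lemma sigma_ne_zero {z : ℂ} (hz : z ∉ L.lattice) : sigma L z ≠ 0 := by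
  rw [sigma_eq_mul_sigmaProd]
  exact mul_ne_zero (fun h ↦ hz (h ▸ zero_mem _)) (sigmaProd_ne_zero L (.inl hz))

lemma deriv_sigma_zero_ne_zero : deriv (sigma L) 0 ≠ 0 := by
  have h := (hasDerivAt_id (0 : ℂ)).mul (differentiable_sigmaProd L 0).hasDerivAt
  have h' : deriv (sigma L) 0 = _ :=
    (h.congr_of_eventuallyEq (.of_forall (sigma_eq_mul_sigmaProd L))).deriv
  rw [h']
  simpa using sigmaProd_ne_zero L (.inr rfl)

/-! ### Quasi-periodicity of `σ` -/

lemma isOpen_compl_lattice : IsOpen (L.latticeᶜ : Set ℂ) := L.isClosed_lattice.isOpen_compl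

lemma countable_lattice : (L.lattice : Set ℂ).Countable := by
  have := countable_of_Lindelof_of_discrete (X := L.lattice)
  exact Set.to_countable _

lemma isPreconnected_compl_lattice : IsPreconnected (L.latticeᶜ : Set ℂ) :=
  ((countable_lattice L).isConnected_compl_of_one_lt_rank (by simp)).isPreconnected

lemma dense_compl_lattice : Dense (L.latticeᶜ : Set ℂ) := (countable_lattice L).dense_compl ℝ

/-- The sum of the logarithmic derivatives of the canonical factors, that is `ζ(z) - 1 / z` for
the Weierstrass `ζ`-function. The term of `ω = 0` is zero, by the convention on division by zero. -/
noncomputable def zetaSum (z : ℂ) : ℂ := ∑' ω : L.lattice, z ^ 2 / ((ω : ℂ) ^ 2 * (z - ω))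

lemma hasSumLocallyUniformly_zetaSum :
    HasSumLocallyUniformly (fun (ω : L.lattice) (z : ℂ) ↦ z ^ 2 / ((ω : ℂ) ^ 2 * (z - ω)))
      (zetaSum L) := by
  refine L.hasSumLocallyUniformly_aux (u := fun r ω ↦ 2 * r ^ 2 * ‖(ω : ℂ)‖ ^ (-3 : ℝ)) _
    (fun r _ ↦ (summable_lattice_norm_rpow L).mul_left _) fun r hr ↦
    eventually_atTop.mpr ⟨2 * r, ?_⟩
  rintro _ h z hz ω rfl
  have hω : 0 < ‖(ω : ℂ)‖ := by linarith
  have hsub : ‖(ω : ℂ)‖ / 2 ≤ ‖z - ω‖ := by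
    rw [norm_sub_rev]
    exact .trans (by linarith) (norm_sub_norm_le _ _)
  have hpow : ‖(ω : ℂ)‖ ^ (-3 : ℝ) = (‖(ω : ℂ)‖ ^ 3)⁻¹ := by
    rw [Real.rpow_neg hω.le]
    norm_cast
  rw [hpow, norm_div, norm_mul, norm_pow, norm_pow]
  calc ‖z‖ ^ 2 / (‖(ω : ℂ)‖ ^ 2 * ‖z - ω‖) ≤ r ^ 2 / (‖(ω : ℂ)‖ ^ 2 * (‖(ω : ℂ)‖ / 2)) := by
        gcongr
    _ = 2 * r ^ 2 * (‖(ω : ℂ)‖ ^ 3)⁻¹ := by field_simp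

lemma differentiableOn_zetaSum_term (ω : L.lattice) :
    DifferentiableOn ℂ (fun z : ℂ ↦ z ^ 2 / ((ω : ℂ) ^ 2 * (z - ω))) L.latticeᶜ := by
  rcases eq_or_ne (ω : ℂ) 0 with h0 | h0
  · simp [h0]
  refine .div (by fun_prop) (by fun_prop) fun z hz ↦ mul_ne_zero (pow_ne_zero 2 h0) ?_
  exact sub_ne_zero.mpr fun h ↦ hz (h ▸ ω.2)

lemma hasDerivAt_zetaSum_term {ω z : ℂ} (h : z ≠ ω) :
    HasDerivAt (fun z : ℂ ↦ z ^ 2 / (ω ^ 2 * (z - ω)))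
      (if ω = 0 then 0 else -(1 / (z - ω) ^ 2 - 1 / ω ^ 2)) z := by
  split_ifs with h0
  · simpa [h0] using hasDerivAt_const z (0 : ℂ)
  have h1 : z - ω ≠ 0 := sub_ne_zero.mpr h
  refine ((hasDerivAt_pow 2 z).div (((hasDerivAt_id z).sub_const ω).const_mul (ω ^ 2))
    (mul_ne_zero (pow_ne_zero 2 h0) h1)).congr_deriv ?_
  simp only [id]
  field_simp
  ring

lemma differentiableOn_zetaSum : DifferentiableOn ℂ (zetaSum L) L.latticeᶜ :=
  (hasSumLocallyUniformly_zetaSum L).tendstoLocallyUniformlyOn.differentiableOn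
    (.of_forall fun _ ↦ .fun_sum fun ω _ ↦ differentiableOn_zetaSum_term L ω)
    (isOpen_compl_lattice L)

lemma deriv_zetaSum {z : ℂ} (hz : z ∉ L.lattice) :
    deriv (zetaSum L) z = -(L.weierstrassP z - 1 / z ^ 2) := by
  have h1 := ((hasSumLocallyUniformly_zetaSum L).tendstoLocallyUniformlyOn.deriv
    (.of_forall fun _ ↦ .fun_sum fun ω _ ↦ differentiableOn_zetaSum_term L ω)
    (isOpen_compl_lattice L)).tendsto_at (a := z) hz
  have h2 := (L.hasSum_weierstrassPExcept 0 z).neg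
  have h3 : L.weierstrassPExcept 0 z = L.weierstrassP z - 1 / z ^ 2 := by
    have := L.weierstrassPExcept_def 0 z
    simp only [ZeroMemClass.coe_zero, sub_zero] at this
    rw [this]
    simp
    ring
  rw [← h3]
  refine tendsto_nhds_unique h1 (h2.congr fun s ↦ ?_)
  have h4 : HasDerivAt (fun z : ℂ ↦ ∑ ω ∈ s, z ^ 2 / ((ω : ℂ) ^ 2 * (z - ω))) _ z :=
    HasDerivAt.fun_sum fun ω _ ↦ hasDerivAt_zetaSum_term (ω := (ω : ℂ)) (z := z)
      fun h ↦ hz (h ▸ ω.2)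
  refine Eq.trans ?_ h4.deriv.symm
  refine Finset.sum_congr rfl fun ω _ ↦ ?_
  by_cases h0 : (ω : ℂ) = 0
  · simp only [if_pos h0, neg_zero]
  · simp only [if_neg h0]

lemma logDeriv_sigma {z : ℂ} (hz : z ∉ L.lattice) :
    logDeriv (sigma L) z = 1 / z + zetaSum L z := by
  have hne : ∀ ω : L.lattice, z ≠ ω := fun ω h ↦ hz (h ▸ ω.2)
  have hz0 : z ≠ 0 := fun h ↦ hz (h ▸ zero_mem _)
  have hprod : logDeriv (sigmaProd L) z = zetaSum L z := by
    have := logDeriv_tprod_eq_tsum isOpen_univ (Set.mem_univ z)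
      (f := fun (ω : L.lattice) z ↦ sigmaFactor ω z) (fun ω ↦ sigmaFactor_ne_zero (hne ω))
      (fun ω ↦ (differentiable_sigmaFactor ω).differentiableOn)
      (((hasSumLocallyUniformly_zetaSum L).hasSum (x := z)).summable.congr
        fun ω ↦ (logDeriv_sigmaFactor (hne ω)).symm)
      (multipliableLocallyUniformlyOn_sigmaFactor L) (sigmaProd_ne_zero L (.inl hz))
    exact this.trans (tsum_congr fun ω ↦ logDeriv_sigmaFactor (hne ω))
  rw [funext (sigma_eq_mul_sigmaProd L), logDeriv_mul (f := fun z ↦ z) z hz0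
    (sigmaProd_ne_zero L (.inl hz)) differentiableAt_id (differentiable_sigmaProd L z),
    hprod, logDeriv_id']

lemma hasDerivAt_logDeriv_sigma {z : ℂ} (hz : z ∉ L.lattice) :
    HasDerivAt (logDeriv (sigma L)) (-L.weierstrassP z) z := by
  have hU := (isOpen_compl_lattice L).mem_nhds hz
  have h0 : z ≠ 0 := fun h ↦ hz (h ▸ zero_mem _)
  have h1 := ((differentiableOn_zetaSum L).differentiableAt hU).hasDerivAt
  rw [deriv_zetaSum L hz] at h1
  have h2 := (hasDerivAt_inv h0).add h1
  refine (h2.congr_of_eventuallyEq ?_).congr_deriv (by ring)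
  filter_upwards [hU] with w hw
  simp [logDeriv_sigma L hw]

/-- `σ` is multiplied by the exponential of an affine function when its argument is shifted by a
period. The constants are not needed. -/
theorem exists_sigma_add_eq {ω : ℂ} (hω : ω ∈ L.lattice) :
    ∃ C c : ℂ, C ≠ 0 ∧ ∀ z, sigma L (z + ω) = C * exp (c * z) * sigma L z := by
  have hadd : ∀ {z}, z ∈ (L.latticeᶜ : Set ℂ) → z + ω ∉ L.lattice := fun {z} hz h ↦
    hz (by simpa using sub_mem h hω)
  have hshift : ∀ z, deriv (fun z ↦ sigma L (z + ω)) z = deriv (sigma L) (z + ω) :=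
    fun z ↦ deriv_comp_add_const _ _ _
  have hD : ∀ z ∈ (L.latticeᶜ : Set ℂ), HasDerivAt
      (fun z ↦ logDeriv (sigma L) (z + ω) - logDeriv (sigma L) z) 0 z := by
    intro z hz
    have h := ((hasDerivAt_logDeriv_sigma L (hadd hz)).comp_add_const z ω).sub
      (hasDerivAt_logDeriv_sigma L hz)
    rw [L.weierstrassP_add_coe z ⟨ω, hω⟩, sub_self] at h
    exact h
  obtain ⟨c, hc⟩ := (isOpen_compl_lattice L).exists_is_const_of_deriv_eq_zero
    (isPreconnected_compl_lattice L)
    (fun z hz ↦ (hD z hz).differentiableAt.differentiableWithinAt) fun z hz ↦ (hD z hz).deriv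
  have hexp : Differentiable ℂ fun z ↦ exp (c * z) := by fun_prop
  have hlog : Set.EqOn (logDeriv fun z ↦ sigma L (z + ω))
      (logDeriv fun z ↦ exp (c * z) * sigma L z) L.latticeᶜ := by
    intro z hz
    rw [logDeriv_mul (f := fun z ↦ exp (c * z)) z (exp_ne_zero _)
        (sigma_ne_zero L hz) (hexp z) (differentiable_sigma L z),
      logDeriv_apply, hshift, ← logDeriv_apply (sigma L)]
    have : logDeriv (fun z ↦ exp (c * z)) z = c := by
      have := (((hasDerivAt_id' z).const_mul c).cexp).deriv
      rw [logDeriv_apply, this, mul_div_cancel_left₀ _ (exp_ne_zero _), mul_one]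
    rw [this, ← hc z hz]
    ring
  obtain ⟨C, hC, hEq⟩ := (logDeriv_eqOn_iff
    ((differentiable_sigma L).comp (differentiable_id.add_const ω)).differentiableOn
    (hexp.mul (differentiable_sigma L)).differentiableOn (isOpen_compl_lattice L)
    (isPreconnected_compl_lattice L) (fun z hz ↦ mul_ne_zero (exp_ne_zero _) (sigma_ne_zero L hz))
    (fun z hz ↦ sigma_ne_zero L (hadd hz))).mp hlog
  refine ⟨C, c, hC, fun z ↦ ?_⟩
  refine congrFun (Continuous.ext_on (dense_compl_lattice L) (f := fun z ↦ sigma L (z + ω))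
    (g := fun z ↦ C * exp (c * z) * sigma L z) (by fun_prop) (by fun_prop) fun z hz ↦ ?_) z
  simpa [mul_assoc] using hEq hz

/-! ### Zeros of `σ` -/

lemma sigma_eq_zero_iff {z : ℂ} : sigma L z = 0 ↔ z ∈ L.lattice := by
  refine ⟨fun h ↦ not_not.mp fun hz ↦ sigma_ne_zero L hz h, fun hz ↦ ?_⟩
  obtain ⟨C, c, -, h⟩ := exists_sigma_add_eq L hz
  simpa using h 0

/-- The zeros of `σ` are simple. -/
lemma deriv_sigma_ne_zero {ω : ℂ} (hω : ω ∈ L.lattice) : deriv (sigma L) ω ≠ 0 := by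
  obtain ⟨C, c, hC, h⟩ := exists_sigma_add_eq L hω
  have h1 : deriv (fun z ↦ sigma L (z + ω)) 0 = deriv (sigma L) ω := by
    rw [deriv_comp_add_const, zero_add]
  have hexp : Differentiable ℂ fun z ↦ C * exp (c * z) := by fun_prop
  rw [← h1, funext h, deriv_fun_mul (hexp 0) (differentiable_sigma L 0)]
  simpa [hC] using deriv_sigma_zero_ne_zero L

/-! ### Doubly periodic functions and quotients of entire functions -/

/-- Liouville's theorem for elliptic functions without poles. -/
theorem eq_of_differentiable_of_periodic {f : ℂ → ℂ} (hf : Differentiable ℂ f)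
    (hper : ∀ ω ∈ L.lattice, ∀ z, f (z + ω) = f z) (z w : ℂ) : f z = f w := by
  refine hf.apply_eq_apply_of_bounded ?_ z w
  have hK : IsCompact (Metric.closedBall (0 : ℂ) (∑ i, ‖L.basis i‖)) := isCompact_closedBall _ _
  refine (hK.image hf.continuous).isBounded.subset ?_
  rintro _ ⟨x, rfl⟩
  refine ⟨ZSpan.fract L.basis x, by simpa using ZSpan.norm_fract_le L.basis x, ?_⟩
  rw [ZSpan.fract_apply, sub_eq_add_neg]
  refine hper _ (neg_mem ?_) x
  rw [L.lattice_eq_span_range_basis]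
  exact (ZSpan.floor L.basis x).2

open Classical in
/-- The quotient `F / G`, with the value prescribed by l'Hôpital's rule at the zeros of `G`. -/
noncomputable def entireQuotient (F G : ℂ → ℂ) (z : ℂ) : ℂ :=
  if G z = 0 then deriv F z / deriv G z else F z / G z

lemma differentiable_entireQuotient {F G : ℂ → ℂ} (hF : Differentiable ℂ F)
    (hG : Differentiable ℂ G) (hFG : ∀ z, G z = 0 → F z = 0) (hG' : ∀ z, G z = 0 → deriv G z ≠ 0) :
    Differentiable ℂ (entireQuotient F G) := by
  intro p
  by_cases hp : G p = 0
  · -- Near `p` the quotient is that of the difference quotients of `F` and `G` at `p`.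
    have hdF : Differentiable ℂ (dslope F p) :=
      differentiableOn_univ.mp ((differentiableOn_dslope univ_mem).mpr hF.differentiableOn)
    have hdG : Differentiable ℂ (dslope G p) :=
      differentiableOn_univ.mp ((differentiableOn_dslope univ_mem).mpr hG.differentiableOn)
    have hne : dslope G p p ≠ 0 := by
      rw [dslope_same]
      exact hG' p hp
    refine ((hdF p).div (hdG p) hne).congr_of_eventuallyEq ?_
    filter_upwards [hdG.continuous.continuousAt.eventually_ne hne] with z hz
    rcases eq_or_ne z p with rfl | hzp
    · simp [entireQuotient, hp]
    · have hF1 := sub_smul_dslope F p z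
      have hG1 := sub_smul_dslope G p z
      rw [hFG p hp, sub_zero, smul_eq_mul] at hF1
      rw [hp, sub_zero, smul_eq_mul] at hG1
      have hzp' : z - p ≠ 0 := sub_ne_zero.mpr hzp
      have hGz : G z ≠ 0 := hG1 ▸ mul_ne_zero hzp' hz
      rw [entireQuotient, if_neg hGz, ← hF1, ← hG1, mul_div_mul_left _ _ hzp']
      rfl
  · refine ((hF p).div (hG p) hp).congr_of_eventuallyEq ?_
    filter_upwards [hG.continuous.continuousAt.eventually_ne hp] with z hz
    simp [entireQuotient, hz]

/-- Two entire functions with the same multipliers along the lattice are proportional if one of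
them has only simple zeros and the other one vanishes at them. -/
theorem exists_eq_const_mul_of_same_multiplier {F G : ℂ → ℂ}
    (hF : Differentiable ℂ F) (hG : Differentiable ℂ G) (hFG : ∀ z, G z = 0 → F z = 0)
    (hG' : ∀ z, G z = 0 → deriv G z ≠ 0)
    (hmul : ∀ ω ∈ L.lattice, ∃ e : ℂ → ℂ, Differentiable ℂ e ∧ (∀ z, e z ≠ 0) ∧
      (∀ z, F (z + ω) = e z * F z) ∧ ∀ z, G (z + ω) = e z * G z) :
    ∃ k : ℂ, ∀ z, F z = k * G z := by
  refine ⟨entireQuotient F G 0, fun z ↦ ?_⟩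
  have hconst := eq_of_differentiable_of_periodic L
    (differentiable_entireQuotient hF hG hFG hG') ?_ 0 z
  · rw [hconst]
    by_cases hz : G z = 0
    · rw [hz, hFG z hz, mul_zero]
    · rw [entireQuotient, if_neg hz, div_mul_cancel₀ _ hz]
  intro ω hω z
  obtain ⟨e, he, he0, hFe, hGe⟩ := hmul ω hω
  by_cases hz : G z = 0
  · have hderiv : ∀ H : ℂ → ℂ, Differentiable ℂ H → H z = 0 → (∀ z, H (z + ω) = e z * H z) →
        deriv H (z + ω) = e z * deriv H z := by
      intro H hH h0 hHe
      rw [← deriv_comp_add_const, funext hHe, deriv_fun_mul (he z) (hH z), h0, mul_zero, zero_add]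
    rw [entireQuotient, entireQuotient, if_pos hz, if_pos (by rw [hGe, hz, mul_zero]),
      hderiv F hF (hFG z hz) hFe, hderiv G hG hz hGe, mul_div_mul_left _ _ (he0 z)]
  · rw [entireQuotient, entireQuotient, if_neg hz, if_neg (hGe z ▸ mul_ne_zero (he0 z) hz),
      hFe, hGe, mul_div_mul_left _ _ (he0 z)]

/-! ### The three-term relation -/

/-- The multiplier of `σ(z - p) σ(z - q)` depends on `p` and `q` through `p + q` only. -/
lemma exists_multiplier_sigma_mul_sigma {ω : ℂ} (hω : ω ∈ L.lattice) (s : ℂ) :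
    ∃ e : ℂ → ℂ, Differentiable ℂ e ∧ (∀ z, e z ≠ 0) ∧ ∀ p q, p + q = s → ∀ z,
      sigma L (z + ω - p) * sigma L (z + ω - q) = e z * (sigma L (z - p) * sigma L (z - q)) := by
  obtain ⟨C, c, hC, h⟩ := exists_sigma_add_eq L hω
  refine ⟨fun z ↦ C ^ 2 * exp (c * (2 * z - s)), by fun_prop,
    fun z ↦ mul_ne_zero (pow_ne_zero 2 hC) (exp_ne_zero _), fun p q hpq z ↦ ?_⟩
  subst hpq
  simp only [add_sub_right_comm z ω, h]
  rw [show c * (2 * z - (p + q)) = c * (z - p) + c * (z - q) by ring, exp_add]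
  ring

lemma sigma_three_term_of_notMem {a b t v : ℂ} (hb : v - b ∉ L.lattice)
    (hat : v - a - t ∉ L.lattice) (h2 : 2 * v - (a + b + t) ∉ L.lattice) (u : ℂ) :
    sigma L (u - a - t) * sigma L (v - b - t) * sigma L (v - a) * sigma L (u - b) -
        sigma L (u - b - t) * sigma L (v - a - t) * sigma L (u - a) * sigma L (v - b) =
      sigma L (a - b) * sigma L (u - v) * sigma L (u + v - a - b - t) * sigma L t := by
  set F : ℂ → ℂ := fun u ↦
    sigma L (v - b - t) * sigma L (v - a) * (sigma L (u - (a + t)) * sigma L (u - b)) -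
      sigma L (v - a - t) * sigma L (v - b) * (sigma L (u - (b + t)) * sigma L (u - a)) with hFdef
  set G : ℂ → ℂ := fun u ↦ sigma L (u - v) * sigma L (u - (a + b + t - v)) with hGdef
  have hσ := differentiable_sigma L
  have hsub : ∀ p, Differentiable ℂ fun u ↦ sigma L (u - p) := fun p ↦
    hσ.comp (differentiable_id.sub_const p)
  have hF : Differentiable ℂ F :=
    (((hsub _).mul (hsub _)).const_mul _).sub (((hsub _).mul (hsub _)).const_mul _)
  have hG : Differentiable ℂ G := (hsub _).mul (hsub _)
  have hmul : ∀ ω ∈ L.lattice, ∃ e : ℂ → ℂ, Differentiable ℂ e ∧ (∀ z, e z ≠ 0) ∧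
      (∀ z, F (z + ω) = e z * F z) ∧ ∀ z, G (z + ω) = e z * G z := by
    intro ω hω
    obtain ⟨e, he, he0, h⟩ := exists_multiplier_sigma_mul_sigma L hω (a + b + t)
    refine ⟨e, he, he0, fun z ↦ ?_, fun z ↦ h _ _ (by ring) z⟩
    simp only [hFdef]
    rw [h (a + t) b (by ring), h (b + t) a (by ring)]
    ring
  have hFv : F v = 0 := by
    simp only [hFdef, ← sub_sub]
    ring
  have hFv' : F (a + b + t - v) = 0 := by
    simp only [hFdef]
    rw [show a + b + t - v - (a + t) = b - v by ring, show a + b + t - v - b = a + t - v by ring,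
      show a + b + t - v - (b + t) = a - v by ring, show a + b + t - v - a = b + t - v by ring,
      sigma_sub_comm L b v, sigma_sub_comm L a v, sigma_sub_comm L (a + t) v,
      sigma_sub_comm L (b + t) v]
    simp only [← sub_sub]
    ring
  -- A function with these multipliers vanishes along whole lattice translates.
  have hFtrans : ∀ {z p : ℂ}, z - p ∈ L.lattice → F p = 0 → F z = 0 := by
    intro z p hzp hp
    obtain ⟨e, -, -, he, -⟩ := hmul _ hzp
    have := he p
    rwa [hp, mul_zero, add_sub_cancel] at this
  have hFG : ∀ z, G z = 0 → F z = 0 := by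
    intro z hz
    rcases mul_eq_zero.mp hz with hz | hz
    · exact hFtrans ((sigma_eq_zero_iff L).mp hz) hFv
    · exact hFtrans ((sigma_eq_zero_iff L).mp hz) hFv'
  have hG' : ∀ z, G z = 0 → deriv G z ≠ 0 := by
    intro z hz
    have hd : deriv G z = deriv (sigma L) (z - v) * sigma L (z - (a + b + t - v)) +
        sigma L (z - v) * deriv (sigma L) (z - (a + b + t - v)) := by
      rw [hGdef, deriv_fun_mul (hsub _ z) (hsub _ z), deriv_comp_sub_const, deriv_comp_sub_const]
    rw [hd]
    -- The two families of zeros of `G` are disjoint, so only one factor vanishes at `z`.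
    rcases mul_eq_zero.mp hz with hz | hz <;> have hm := (sigma_eq_zero_iff L).mp hz
    · rw [hz, zero_mul, add_zero]
      refine mul_ne_zero (deriv_sigma_ne_zero L hm) (sigma_ne_zero L fun h ↦ h2 ?_)
      convert sub_mem h hm using 1
      ring
    · rw [hz, mul_zero, zero_add]
      refine mul_ne_zero (sigma_ne_zero L fun h ↦ h2 ?_) (deriv_sigma_ne_zero L hm)
      convert sub_mem hm h using 1
      ring
  obtain ⟨k, hk⟩ := exists_eq_const_mul_of_same_multiplier L hF hG hFG hG' hmul
  -- The constant is found at `u = b`, where one of the two terms of `F` vanishes.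
  have hkval : k = sigma L (a - b) * sigma L t := by
    have hkb := hk b
    simp only [hFdef, hGdef] at hkb
    rw [sub_self, sigma_zero, show b - (b + t) = -t by ring,
      show b - (a + b + t - v) = v - a - t by ring, sigma_neg, sigma_sub_comm L b v,
      sigma_sub_comm L b a] at hkb
    refine mul_right_cancel₀ (mul_ne_zero (sigma_ne_zero L hb) (sigma_ne_zero L hat)) ?_
    linear_combination hkb
  have hku := hk u
  simp only [hFdef, hGdef, hkval] at hku
  rw [show u - (a + b + t - v) = u + v - a - b - t by ring] at hku
  simp only [← sub_sub] at hku
  linear_combination hku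

/-- The three-term relation of the Weierstrass `σ`-function. -/
theorem sigma_three_term (a b t u v : ℂ) :
    sigma L (u - a - t) * sigma L (v - b - t) * sigma L (v - a) * sigma L (u - b) -
        sigma L (u - b - t) * sigma L (v - a - t) * sigma L (u - a) * sigma L (v - b) =
      sigma L (a - b) * sigma L (u - v) * sigma L (u + v - a - b - t) * sigma L t := by
  -- Both sides are continuous in `v`, and the excluded values of `v` are countable in number.
  set S : Set ℂ := (fun ω ↦ ω + b) '' L.lattice ∪ (fun ω ↦ ω + a + t) '' L.lattice ∪
    (fun ω ↦ (ω + (a + b + t)) / 2) '' L.lattice with hS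
  have hcount := countable_lattice L
  have hdense : Dense Sᶜ :=
    (((hcount.image _).union (hcount.image _)).union (hcount.image _)).dense_compl ℝ
  refine congrFun (Continuous.ext_on hdense
    (f := fun v ↦ sigma L (u - a - t) * sigma L (v - b - t) * sigma L (v - a) * sigma L (u - b) -
        sigma L (u - b - t) * sigma L (v - a - t) * sigma L (u - a) * sigma L (v - b))
    (g := fun v ↦ sigma L (a - b) * sigma L (u - v) * sigma L (u + v - a - b - t) * sigma L t)
    (by fun_prop) (by fun_prop) fun v hv ↦ ?_) v
  refine sigma_three_term_of_notMem L (fun h ↦ hv ?_) (fun h ↦ hv ?_) (fun h ↦ hv ?_) u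
  · exact .inl (.inl ⟨_, h, by ring⟩)
  · exact .inl (.inr ⟨_, h, by ring⟩)
  · exact .inr ⟨_, h, by ring⟩

/-! ### The hypermatrix of the bilinear system -/

/-- Testing the forms on pairs of basis vectors recovers the coefficients. -/
lemma isIdentified_iff (A B : Fin 3 → Fin 2 → ℂ) (i i₁ i₂ : Fin 3) {l l₁ : Fin 2} (hl : l ≠ l₁)
    (a : Hypermatrix) :
    IsIdentified A B i i₁ i₂ l l₁ a ↔ a = systemHypermatrix A B i i₁ i₂ l l₁ := by
  have hcases : (l = 0 ∧ l₁ = 1) ∨ (l = 1 ∧ l₁ = 0) := by omega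
  constructor
  · intro h
    have h00 := h ![1, 0] ![1, 0]
    have h01 := h ![1, 0] ![0, 1]
    have h10 := h ![0, 1] ![1, 0]
    have h11 := h ![0, 1] ![0, 1]
    funext p q r
    rcases hcases with ⟨rfl, rfl⟩ | ⟨rfl, rfl⟩ <;>
      simp [cayleyForm, bilinearForm] at h00 h01 h10 h11 <;>
      fin_cases p <;> fin_cases q <;> fin_cases r <;> simp [systemHypermatrix, h00, h01, h10, h11]
  · rintro rfl h k
    rcases hcases with ⟨rfl, rfl⟩ | ⟨rfl, rfl⟩ <;>
      constructor <;> simp [cayleyForm, bilinearForm, systemHypermatrix] <;> ring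

lemma systemHypermatrix_eq_compoundHypermatrix (A B : Fin 3 → Fin 2 → ℂ) (i i₁ i₂ : Fin 3)
    (l l₁ : Fin 2) (p q r : Fin 2) :
    systemHypermatrix A B i i₁ i₂ l l₁ p q r =
      compoundHypermatrix ![A i l, A i₁ l, A i₂ l] ![B i l, B i₁ l, B i₂ l]
        ![A i l₁, A i₁ l₁, A i₂ l₁] ![B i l₁, B i₁ l₁, B i₂ l₁] r q p := by
  fin_cases p <;> fin_cases q <;> fin_cases r <;>
    simp [systemHypermatrix, compoundHypermatrix, Matrix.det_fin_two]

lemma hyperdet_systemHypermatrix_eq_compoundHyperdet (A B : Fin 3 → Fin 2 → ℂ) (i i₁ i₂ : Fin 3)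
    (l l₁ : Fin 2) :
    hyperdet (systemHypermatrix A B i i₁ i₂ l l₁) =
      compoundHyperdet ![A i l, A i₁ l, A i₂ l] ![B i l, B i₁ l, B i₂ l]
        ![A i l₁, A i₁ l₁, A i₂ l₁] ![B i l₁, B i₁ l₁, B i₂ l₁] := by
  simp [hyperdet, systemHypermatrix, compoundHyperdet, Matrix.det_fin_two]
  ring

lemma hyperdet_systemHypermatrix_eq_sq (A B : Fin 3 → Fin 2 → ℂ) (i i₁ i₂ : Fin 3)
    (l l₁ : Fin 2) :
    hyperdet (systemHypermatrix A B i i₁ i₂ l l₁) =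
      !![minor A i i₂ l l₁, minor A i₁ i₂ l l₁; minor B i i₂ l l₁, minor B i₁ i₂ l l₁].det ^ 2 := by
  simp [hyperdet, systemHypermatrix, minor, Matrix.det_fin_two]
  ring

/-! ### Factorisation of the minors -/

/-- After clearing denominators this is the three-term relation with `t = ξ̂₃ - ξ_j - β`. -/
theorem minor_coeffA_eq_sigmaProduct (α β : ℂ) (η ξh ξ : Fin 3 → ℂ)
    (h₁ : ∀ i m, η i - ξh m - α ∉ L.lattice) (h₂ : ∀ m j, ξh m - ξ j - β ∉ L.lattice)
    (i i₂ j : Fin 3) (l l₁ : Fin 2) :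
    minor (fun i l ↦ coeffA L α β η ξh ξ i l j) i i₂ l l₁ =
      sigmaProduct L α β η ξh ξ i i₂ l l₁ j := by
  have key := sigma_three_term L (ξh l.castSucc) (ξh l₁.castSucc) (ξh 2 - ξ j - β)
    (η i - α) (η i₂ - α)
  have e₁ : ∀ (i m : Fin 3), η i - α - ξh m = η i - ξh m - α := fun i m ↦ by ring
  have e₂ : ∀ (i m : Fin 3), η i - α - ξh m - (ξh 2 - ξ j - β) =
      η i - ξh m - ξh 2 + ξ j - α + β := fun i m ↦ by ring
  rw [e₂, e₂, e₂, e₂, e₁, e₁, e₁, e₁, sub_sub_sub_cancel_right,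
    show η i - α + (η i₂ - α) - ξh l.castSucc - ξh l₁.castSucc - (ξh 2 - ξ j - β) =
      η i + η i₂ - ξh l.castSucc - ξh l₁.castSucc - ξh 2 + ξ j - 2 * α + β by ring] at key
  have n₁ := fun i m ↦ sigma_ne_zero L (h₁ i m)
  have n₂ := fun m ↦ sigma_ne_zero L (h₂ m j)
  have a₁ := n₁ i l.castSucc
  have a₂ := n₁ i l₁.castSucc
  have a₃ := n₁ i₂ l.castSucc
  have a₄ := n₁ i₂ l₁.castSucc
  have a₅ := n₁ i 2
  have a₆ := n₁ i₂ 2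
  have a₇ := n₂ l.castSucc
  have a₈ := n₂ l₁.castSucc
  have a₉ := n₂ 2
  simp only [minor, Matrix.det_fin_two_of, coeffA, sigmaProduct]
  generalize sigma L (η i - ξh l.castSucc - α) = x₁ at *
  generalize sigma L (η i - ξh l₁.castSucc - α) = x₂ at *
  generalize sigma L (η i₂ - ξh l.castSucc - α) = x₃ at *
  generalize sigma L (η i₂ - ξh l₁.castSucc - α) = x₄ at *
  generalize sigma L (η i - ξh 2 - α) = x₅ at *
  generalize sigma L (η i₂ - ξh 2 - α) = x₆ at *
  generalize sigma L (ξh l.castSucc - ξ j - β) = x₇ at *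
  generalize sigma L (ξh l₁.castSucc - ξ j - β) = x₈ at *
  generalize sigma L (ξh 2 - ξ j - β) = x₉ at *
  rw [div_mul_div_comm, div_mul_div_comm, div_sub_div _ _ (by positivity) (by positivity),
    div_mul_div_comm, div_eq_div_iff (by positivity) (by positivity)]
  linear_combination (sigma L (ξh l.castSucc - ξh 2) * sigma L (ξh l₁.castSucc - ξh 2) *
    (x₁ * x₂ * x₃ * x₄ * x₅ ^ 2 * x₆ ^ 2 * x₇ ^ 2 * x₈ ^ 2 * x₉ ^ 3)) * key

/-- The coefficients `B` arise from the coefficients `A` by exchanging `α` and `β`. -/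
lemma coeffB_eq_coeffA (α β : ℂ) (η ξt ξ : Fin 3 → ℂ) (i : Fin 3) (l : Fin 2)
    (j : Fin 3) : coeffB L α β η ξt ξ i l j = coeffA L β α η ξt ξ i l j := by
  rw [coeffA, coeffB, show η i - ξt l.castSucc - ξt 2 + ξ j + α - β =
    η i - ξt l.castSucc - ξt 2 + ξ j - β + α by ring]

end EllipticLax

theorem proposition3p3 (L : PeriodPair) (α β : ℂ)
    -- the values of the variables at the four vertices of an elementary quadrilateral
    (ξ ξt ξh ξth : Fin 3 → ℂ)
    -- no denominator vanishes
    (hA₁ : ∀ i m : Fin 3, ξth i - ξh m - α ∉ L.lattice)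
    (hA₂ : ∀ m j : Fin 3, ξh m - ξ j - β ∉ L.lattice)
    (hB₁ : ∀ i m : Fin 3, ξth i - ξt m - β ∉ L.lattice)
    (hB₂ : ∀ m j : Fin 3, ξt m - ξ j - α ∉ L.lattice)
    (A B : Fin 3 → Fin 3 → Fin 2 → ℂ)
    (hA : A = fun j i l => EllipticLax.coeffA L α β ξth ξh ξ i l j)
    (hB : B = fun j i l => EllipticLax.coeffB L α β ξth ξt ξ i l j) :
    -- the hypermatrix, its compound form and its hyperdeterminant
    (∀ (j i i₁ i₂ : Fin 3) (l l₁ : Fin 2), l ≠ l₁ →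
      (∀ a : EllipticLax.Hypermatrix, EllipticLax.IsIdentified (A j) (B j) i i₁ i₂ l l₁ a ↔
        a = EllipticLax.systemHypermatrix (A j) (B j) i i₁ i₂ l l₁) ∧
      (∀ p q r : Fin 2, EllipticLax.systemHypermatrix (A j) (B j) i i₁ i₂ l l₁ p q r =
        EllipticLax.compoundHypermatrix
          ![A j i l, A j i₁ l, A j i₂ l] ![B j i l, B j i₁ l, B j i₂ l]
          ![A j i l₁, A j i₁ l₁, A j i₂ l₁] ![B j i l₁, B j i₁ l₁, B j i₂ l₁] r q p) ∧
      EllipticLax.hyperdet (EllipticLax.systemHypermatrix (A j) (B j) i i₁ i₂ l l₁) =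
        EllipticLax.compoundHyperdet
          ![A j i l, A j i₁ l, A j i₂ l] ![B j i l, B j i₁ l, B j i₂ l]
          ![A j i l₁, A j i₁ l₁, A j i₂ l₁] ![B j i l₁, B j i₁ l₁, B j i₂ l₁] ∧
      EllipticLax.hyperdet (EllipticLax.systemHypermatrix (A j) (B j) i i₁ i₂ l l₁) =
        !![EllipticLax.minor (A j) i i₂ l l₁, EllipticLax.minor (A j) i₁ i₂ l l₁;
          EllipticLax.minor (B j) i i₂ l l₁, EllipticLax.minor (B j) i₁ i₂ l l₁].det ^ 2) ∧
    -- the factorisation of the determinants of the `A_{ilj}`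
    (∀ (j i i₂ : Fin 3) (l l₁ : Fin 2),
      EllipticLax.minor (A j) i i₂ l l₁ =
        EllipticLax.sigmaProduct L α β ξth ξh ξ i i₂ l l₁ j) ∧
    -- the factorisation of the determinants of the `B_{ilj}`
    (∀ (j i i₂ : Fin 3) (l l₁ : Fin 2),
      EllipticLax.minor (B j) i i₂ l l₁ =
        EllipticLax.sigmaProduct L β α ξth ξt ξ i i₂ l l₁ j) := by
  subst hA hB
  refine ⟨fun j i i₁ i₂ l l₁ hl ↦ ⟨fun a ↦ EllipticLax.isIdentified_iff _ _ i i₁ i₂ hl a,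
    EllipticLax.systemHypermatrix_eq_compoundHypermatrix _ _ i i₁ i₂ l l₁,
    EllipticLax.hyperdet_systemHypermatrix_eq_compoundHyperdet _ _ i i₁ i₂ l l₁,
    EllipticLax.hyperdet_systemHypermatrix_eq_sq _ _ i i₁ i₂ l l₁⟩,
    fun j i i₂ l l₁ ↦ EllipticLax.minor_coeffA_eq_sigmaProduct L α β ξth ξh ξ hA₁ hA₂ i i₂ j l l₁,
    fun j i i₂ l l₁ ↦ ?_⟩
  simp only [EllipticLax.coeffB_eq_coeffA]
  exact EllipticLax.minor_coeffA_eq_sigmaProduct L β α ξth ξt ξ hB₁ hB₂ i i₂ j l l₁
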